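/- Let $k\ge 1$, let $I=\mathbb{Z}/(k+1)=\{0,1,\dots,k\}$, and let $\tilde S_{k+1}$ be the group of affine permutations, i.e. bijections $x:\mathbb{Z}\to\mathbb{Z}$ with $x(i+k+1)=x(i)+k+1$ and $\sum_{i=1}^{k+1}x(i)=\binom{k+2}{2}$, generated by the simple transpositions $s_i$ ($i\in I$), where $s_i$ exchanges $m$ and $m+1$ for all $m\equiv i \pmod{k+1}$. Put $D_R(x)=\{i\in I: x(i)>x(i+1)\}$. For $A\subsetneq I$ let $d_A$ be the product of the $s_i$, $i\in A$, each taken once, with $j$ to the left of $j-1$ whenever $j,j-1\in A$. A cyclically decreasing decomposition of $x$ is a list $\vec A=(A_1,\dots,A_n)$ of proper subsets of $I$ with $x=d_{A_n}\cdots d_{A_1}$, where the word of the product is reduced (equivalently, the identity holds between nonzero elements of the affine nil-Coxeter monoid). It is maximal if $(|A_1|,\dots,|A_n|)$, continued by zeros, is lexicographically maximal among all such decompositions of $x$. A $k$-code is a function $\alpha:I\to\mathbb{Z}_{\ge0}$ with at least one zero value; its filling has a box in column $c$ and row $j$ ($j=1,2,\dots$) if and only if $j\le\alpha_c$, and this box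 is marked with the residue $c-j+1$. Let $x=d_{A_n}\cdots d_{A_1}$ be a maximal cyclically decreasing decomposition of an affine permutation $x$. Then there is exactly one $k$-code $\alpha$ whose filling $T=\sigma(x)$ has, for every $j$, the set of residues $A_j$ in row $j$ (with $A_j=\emptyset$ for $j>n$). Moreover: 1. for every $r\in I$, $r\in D_R(x)$ if and only if $r$ appears in the first row of $T$ and the column containing this box contains, in some row $j$, a residue that is a right descent of $d_{A_j}$; 2. $D_R(x)=\{r\in I:\alpha_{r-1}<\alpha_r\}$, that is, the right descents of $x$ are the descents of its $k$-code. -/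

import Mathlib

namespace AffineCode

/-- Affine permutations for the index set `I = ZMod (k + 1)`: bijections `x : ℤ → ℤ` with
`x (i + k + 1) = x i + k + 1` and `x 1 + ... + x (k + 1) = (k + 2 choose 2)`. -/
def IsAffinePerm (k : ℕ) (x : Equiv.Perm ℤ) : Prop :=
  (∀ i : ℤ, x (i + (k + 1)) = x i + (k + 1)) ∧
    ∑ i ∈ Finset.Icc (1 : ℤ) (k + 1), x i = ((k + 2).choose 2 : ℤ)

/-- The underlying map of the simple transposition `s_i`: it exchanges `m` and `m + 1` for every
integer `m` congruent to `i` modulo `k + 1`. -/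
def simpleFun (k : ℕ) (i : ZMod (k + 1)) (m : ℤ) : ℤ :=
  if (m : ZMod (k + 1)) = i then m + 1
  else if (m : ZMod (k + 1)) = i + 1 then m - 1
  else m

theorem simpleFun_involutive (k : ℕ) [NeZero k] (i : ZMod (k + 1)) :
    Function.Involutive (simpleFun k i) := by
  have : Fact (1 < k + 1) := ⟨by have := Nat.pos_of_ne_zero (NeZero.ne k); omega⟩
  intro m
  unfold simpleFun
  by_cases h1 : (m : ZMod (k + 1)) = i
  · simp [h1]
  · by_cases h2 : (m : ZMod (k + 1)) = i + 1
    · simp [h2]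
    · simp [h1, h2]

/-- The generator `s_i`, `i ∈ I`, of the affine symmetric group, for `k ≥ 1`. -/
def simpleRefl (k : ℕ) [NeZero k] (i : ZMod (k + 1)) : Equiv.Perm ℤ :=
  (simpleFun_involutive k i).toPerm

/-- `s_{w_1} s_{w_2} ⋯ s_{w_l}`; the product is composition of maps, so that multiplying on the
right acts on positions. -/
def wordProd (k : ℕ) [NeZero k] (w : List (ZMod (k + 1))) : Equiv.Perm ℤ :=
  (w.map (simpleRefl k)).prod

/-- `w` is a reduced word for `x`: its product is `x`, and no shorter word has product `x`.
The product of the word in the nil-Coxeter monoid is then nonzero, and is the element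
corresponding to `x`. -/
def IsReducedWord (k : ℕ) [NeZero k] (w : List (ZMod (k + 1))) (x : Equiv.Perm ℤ) : Prop :=
  wordProd k w = x ∧ ∀ w' : List (ZMod (k + 1)), wordProd k w' = x → w.length ≤ w'.length

/-- The right descent set `D_R(x)`: those `i ∈ I = {0, ..., k}` with `x(i) > x(i + 1)`. -/
def rightDescents (k : ℕ) (x : Equiv.Perm ℤ) : Set (ZMod (k + 1)) :=
  {i | x ((i.val : ℤ) + 1) < x (i.val : ℤ)}

/-- `w` uses each element of `A` exactly once and no other letter, and `j` stands to the left of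
`j - 1` whenever both lie in `A`. -/
def IsCyclicallyDecreasingWord (k : ℕ) (A : Finset (ZMod (k + 1)))
    (w : List (ZMod (k + 1))) : Prop :=
  w.Nodup ∧ w.toFinset = A ∧ ∀ j : ZMod (k + 1), j ∈ A → j - 1 ∈ A → [j, j - 1].Sublist w

open Classical in
/-- A cyclically decreasing word with set of letters `A ⊊ I`: choose `m ∉ A` and list the elements
of `A` in the order `m - 1, m - 2, ..., m - k`.  (Different choices of `m` differ by commutations
only.  For `A = I`, which is never used, the word is empty.) -/
noncomputable def decreasingWord (k : ℕ) (A : Finset (ZMod (k + 1))) : List (ZMod (k + 1)) :=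
  if h : ∃ m, m ∉ A then
    ((List.range k).map (fun t : ℕ => h.choose - 1 - (t : ZMod (k + 1)))).filter (· ∈ A)
  else []

/-- `decreasingWord` does what it should. -/
theorem isCyclicallyDecreasingWord_decreasingWord (k : ℕ) (A : Finset (ZMod (k + 1)))
    (hA : A ≠ Finset.univ) : IsCyclicallyDecreasingWord k A (decreasingWord k A) := by
  have h : ∃ m, m ∉ A := by
    by_contra! hc
    exact hA (Finset.eq_univ_iff_forall.2 hc)
  have hm := h.choose_spec
  have key : ∀ j : ZMod (k + 1), j ∈ A → ∃ t : ℕ, t < k ∧ h.choose - 1 - (t : ZMod (k + 1)) = j := by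
    intro j hj
    refine ⟨(h.choose - 1 - j).val, ?_, by simp⟩
    have h1 : (h.choose - 1 - j).val < k + 1 := ZMod.val_lt _
    rcases Nat.lt_succ_iff_lt_or_eq.1 h1 with h2 | h2
    · exact h2
    · exfalso
      have h3 : ((h.choose - 1 - j).val : ZMod (k + 1)) = (k : ZMod (k + 1)) := by rw [h2]
      rw [ZMod.natCast_zmod_val] at h3
      have h4 : ((k : ZMod (k + 1)) + 1) = 0 := by exact_mod_cast ZMod.natCast_self (k + 1)
      have h5 : h.choose = j := by linear_combination h3 + h4
      exact hm (h5 ▸ hj)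
  have hinj : ∀ s ∈ List.range k, ∀ t ∈ List.range k,
      h.choose - 1 - (s : ZMod (k + 1)) = h.choose - 1 - (t : ZMod (k + 1)) → s = t := by
    intro s hs t ht hst
    have h1 : (s : ZMod (k + 1)) = (t : ZMod (k + 1)) := by linear_combination -hst
    rw [List.mem_range] at hs ht
    rw [ZMod.natCast_eq_natCast_iff'] at h1
    rwa [Nat.mod_eq_of_lt (by omega), Nat.mod_eq_of_lt (by omega)] at h1
  unfold decreasingWord
  rw [dif_pos h]
  refine ⟨(List.Nodup.map_on hinj List.nodup_range).filter _, ?_, ?_⟩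
  · ext j
    simp only [List.mem_toFinset, List.mem_filter, List.mem_map, List.mem_range, decide_eq_true_eq]
    exact ⟨fun hj => hj.2, fun hj => ⟨key j hj, hj⟩⟩
  · intro j hj hj1
    obtain ⟨t, ht, rfl⟩ := key j hj
    obtain ⟨s, hs, hst⟩ := key _ hj1
    have h1 : s = t + 1 := by
      have h2 : (s : ZMod (k + 1)) = ((t + 1 : ℕ) : ZMod (k + 1)) := by
        push_cast
        linear_combination -hst
      rw [ZMod.natCast_eq_natCast_iff'] at h2
      rwa [Nat.mod_eq_of_lt (by omega), Nat.mod_eq_of_lt (by omega)] at h2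
    have h3 : [t, s].Sublist (List.range k) := by
      have h4 : [t, s] = List.range' t 2 := by subst h1; rfl
      have h5 : List.range k = List.range t ++ List.range' t 2 ++ List.range' (t + 2) (k - t - 2) := by
        rw [List.range_eq_range', List.range_eq_range', List.append_assoc,
          List.range'_append_1, ]
        have := List.range'_append_1 (s := 0) (m := t) (n := 2 + (k - t - 2))
        rw [Nat.zero_add] at this
        rw [this]
        congr 1
        omega
      rw [h4, h5]
      exact (List.sublist_append_right _ _).trans (List.sublist_append_left _ _)
    have h6 := (h3.map (fun t : ℕ => h.choose - 1 - (t : ZMod (k + 1)))).filter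
      (fun a => decide (a ∈ A))
    simpa [hj, hj1, hst] using h6

/-- The cyclically decreasing element `d_A`. -/
noncomputable def decreasingElt (k : ℕ) [NeZero k] (A : Finset (ZMod (k + 1))) : Equiv.Perm ℤ :=
  wordProd k (decreasingWord k A)

/-- The word of the product `d_{A_n} ⋯ d_{A_2} d_{A_1}`, where the list is `[A_1, A_2, ..., A_n]`. -/
noncomputable def productWord (k : ℕ) (A : List (Finset (ZMod (k + 1)))) : List (ZMod (k + 1)) :=
  (A.reverse.map (decreasingWord k)).flatten

/-- `x = d_{A_n} ⋯ d_{A_1}` with all `A_i ⊊ I`, as an identity between nonzero elements of the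
nil-Coxeter monoid: the product is `x`, and the word of the product is reduced. -/
def IsDecomposition (k : ℕ) [NeZero k] (x : Equiv.Perm ℤ)
    (A : List (Finset (ZMod (k + 1)))) : Prop :=
  (∀ S ∈ A, S ≠ Finset.univ) ∧ IsReducedWord k (productWord k A) x

/-- Row number `j` (counted from `0`), that is, the set `A_{j+1}`, with `A_i = ∅` for `i > n`. -/
def rowSet (k : ℕ) (A : List (Finset (ZMod (k + 1)))) (j : ℕ) : Finset (ZMod (k + 1)) :=
  A.getD j ∅

/-- The shape `(|A_1|, ..., |A_n|)`, continued by zeros. -/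
def shape (k : ℕ) (A : List (Finset (ZMod (k + 1)))) (j : ℕ) : ℕ :=
  (rowSet k A j).card

/-- `x = d_{A_n} ⋯ d_{A_1}` is a maximal decomposition: its shape is lexicographically maximal among
the shapes of all cyclically decreasing decompositions of `x`. -/
def IsMaximalDecomposition (k : ℕ) [NeZero k] (x : Equiv.Perm ℤ)
    (A : List (Finset (ZMod (k + 1)))) : Prop :=
  IsDecomposition k x A ∧
    ∀ B : List (Finset (ZMod (k + 1))), IsDecomposition k x B →
      toLex (shape k B) ≤ toLex (shape k A)

/-- A `k`-code; `height i` is the number of boxes in column `i` of its diagram. -/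
structure KCode (k : ℕ) where
  height : ZMod (k + 1) → ℕ
  exists_zero : ∃ i, height i = 0

/-- The residue marking the box in column `i` and row `j`, rows being counted from `0`. -/
def residue (k : ℕ) (i : ZMod (k + 1)) (j : ℕ) : ZMod (k + 1) :=
  i - (j : ZMod (k + 1))

/-- The set of residues in row `j` (counted from `0`) of the filling of a `k`-code: there is a box
in column `i` and row `j` exactly when `j < height i`. -/
def KCode.row {k : ℕ} (T : KCode k) (j : ℕ) : Finset (ZMod (k + 1)) :=
  (Finset.univ.filter (fun i => j < T.height i)).image (fun i => residue k i j)

/-- The descents of a `k`-code `α`: the indices `i` with `α_{i-1} < α_i`. -/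
def KCode.descents {k : ℕ} (T : KCode k) : Set (ZMod (k + 1)) :=
  {i | T.height (i - 1) < T.height i}

/-- `T` is the `k`-code filling whose rows are `A_1, A_2, ..., A_n` (and no further rows). -/
def KCode.HasRows {k : ℕ} (T : KCode k) (A : List (Finset (ZMod (k + 1)))) : Prop :=
  ∀ j : ℕ, T.row j = rowSet k A j

end AffineCode

namespace AffineCode

/-! The required `k`-code is the affine Lehmer code: column `c` counts the larger values to the left
of position `c + 1`. Comparing the inversions ending at two adjacent positions shows that `r` is a
right descent exactly when column `r - 1` is lower than column `r`
(`IsPeriodic.mem_rightDescents_iff`), which is claim 2.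

Right multiplication by `s_r` at a descent exchanges columns `r - 1` and `r` and removes one box
from the new column `r - 1` (`code_mul_simpleRefl`). Hence length is the total number of boxes. If a
set `B` can be split off on the right of `x` with lengths adding, every column in `B` is nonzero
(`code_pos_of_invNumber`). Conversely the whole support of the code can be split off, and this
deletes the bottom row and shifts the rest one column to the left (`code_mul_reverse_codeSupport`).
Lexicographic maximality therefore forces the first set to be the support. By induction row `j`
(from 0) contains `c - j` exactly when `j` is less than the height of column `c`
(`IsMaximalDecomposition.mem_rowSet_iff`).

For claim 1, the descents of `d_A` are the `r ∈ A` with `r - 1 ∉ A`; in row `j` this says that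
column `c` reaches the row and column `c - 1` does not. -/

/-! ### Periodic bijections and words in the simple transpositions -/

/-- The periodicity condition for affine permutations. -/
def IsPeriodic (k : ℕ) (x : Equiv.Perm ℤ) : Prop :=
  ∀ i : ℤ, x (i + (k + 1)) = x i + (k + 1)

theorem IsPeriodic.apply_add_mul {k : ℕ} {x : Equiv.Perm ℤ} (hx : IsPeriodic k x) (i t : ℤ) :
    x (i + t * (k + 1)) = x i + t * (k + 1) := by
  induction t using Int.induction_on with
  | zero => simp
  | succ n ih =>
    have := hx (i + n * (k + 1))
    rw [ih] at this
    rw [show i + ((n : ℤ) + 1) * (k + 1) = i + n * (k + 1) + (k + 1) by ring, this]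
    ring
  | pred n ih =>
    have := hx (i + (-(n : ℤ) - 1) * (k + 1))
    rw [show i + (-(n : ℤ) - 1) * (k + 1) + (k + 1) = i + -(n : ℤ) * (k + 1) by ring, ih] at this
    linarith

theorem exists_eq_add_mul {k : ℕ} {i j : ℤ} (h : (i : ZMod (k + 1)) = (j : ZMod (k + 1))) :
    ∃ t : ℤ, i = j + t * (k + 1) := by
  rw [ZMod.intCast_eq_intCast_iff_dvd_sub] at h
  obtain ⟨t, ht⟩ := h
  push_cast at ht
  exact ⟨-t, by linear_combination -ht⟩

theorem IsPeriodic.apply_sub_eq {k : ℕ} {x : Equiv.Perm ℤ} (hx : IsPeriodic k x) {i j : ℤ}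
    (h : (i : ZMod (k + 1)) = (j : ZMod (k + 1))) : x i - i = x j - j := by
  obtain ⟨t, rfl⟩ := exists_eq_add_mul h
  rw [hx.apply_add_mul]
  ring

theorem intCast_val {k : ℕ} (c : ZMod (k + 1)) : ((c.val : ℤ) : ZMod (k + 1)) = c := by simp

theorem isPeriodic_one (k : ℕ) : IsPeriodic k 1 := fun _ => rfl

theorem IsPeriodic.mul {k : ℕ} {x y : Equiv.Perm ℤ} (hx : IsPeriodic k x) (hy : IsPeriodic k y) :
    IsPeriodic k (x * y) := fun i => by
  rw [Equiv.Perm.mul_apply, hy, hx, Equiv.Perm.mul_apply]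

theorem simpleRefl_apply {k : ℕ} [NeZero k] (r : ZMod (k + 1)) (m : ℤ) :
    simpleRefl k r m = if (m : ZMod (k + 1)) = r then m + 1
      else if (m : ZMod (k + 1)) = r + 1 then m - 1 else m := rfl

theorem simpleRefl_mul_self {k : ℕ} [NeZero k] (r : ZMod (k + 1)) :
    simpleRefl k r * simpleRefl k r = 1 := by
  ext m
  exact simpleFun_involutive k r m

theorem isPeriodic_simpleRefl {k : ℕ} [NeZero k] (r : ZMod (k + 1)) :
    IsPeriodic k (simpleRefl k r) := fun i => by
  have h : ((i + (k + 1) : ℤ) : ZMod (k + 1)) = i := by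
    have h4 : ((k : ZMod (k + 1)) + 1) = 0 := by exact_mod_cast ZMod.natCast_self (k + 1)
    push_cast
    rw [h4, add_zero]
  rw [simpleRefl_apply, simpleRefl_apply, h]
  split_ifs <;> ring

theorem isPeriodic_wordProd {k : ℕ} [NeZero k] (w : List (ZMod (k + 1))) :
    IsPeriodic k (wordProd k w) := by
  induction w with
  | nil => exact isPeriodic_one k
  | cons r w ih =>
    rw [wordProd, List.map_cons, List.prod_cons]
    exact (isPeriodic_simpleRefl r).mul ih

theorem wordProd_append {k : ℕ} [NeZero k] (v w : List (ZMod (k + 1))) :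
    wordProd k (v ++ w) = wordProd k v * wordProd k w := by
  simp [wordProd]

theorem wordProd_singleton {k : ℕ} [NeZero k] (r : ZMod (k + 1)) :
    wordProd k [r] = simpleRefl k r := by
  simp [wordProd]

theorem wordProd_mul_wordProd_reverse {k : ℕ} [NeZero k] (w : List (ZMod (k + 1))) :
    wordProd k w * wordProd k w.reverse = 1 := by
  induction w with
  | nil => simp [wordProd]
  | cons r w ih =>
    rw [List.reverse_cons, wordProd_append, ← List.singleton_append, wordProd_append,
      wordProd_singleton, mul_assoc, ← mul_assoc (wordProd k w), ih, one_mul,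
      simpleRefl_mul_self]

theorem natCast_inj_of_le {k u v : ℕ} (hu : u ≤ k) (hv : v ≤ k)
    (h : (u : ZMod (k + 1)) = (v : ZMod (k + 1))) : u = v := by
  rw [ZMod.natCast_eq_natCast_iff'] at h
  rwa [Nat.mod_eq_of_lt (by omega), Nat.mod_eq_of_lt (by omega)] at h

theorem exists_natCast_eq {k : ℕ} (c : ZMod (k + 1)) : ∃ u : ℕ, u ≤ k ∧ (u : ZMod (k + 1)) = c :=
  ⟨c.val, Nat.lt_succ_iff.1 (ZMod.val_lt c), by simp⟩

theorem natCast_succ_self (k : ℕ) : (k : ZMod (k + 1)) + 1 = 0 := by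
  exact_mod_cast ZMod.natCast_self (k + 1)

/-! ### The Lehmer code -/

/-- The positions to the left of `j` with a value larger than that at `j`. -/
def inversionsAt (x : Equiv.Perm ℤ) (j : ℤ) : Set ℤ :=
  {i | i < j ∧ x j < x i}

/-- The affine Lehmer code: entry `c` counts the inversions that end at position `c + 1`. -/
noncomputable def code (k : ℕ) (x : Equiv.Perm ℤ) (c : ZMod (k + 1)) : ℕ :=
  (inversionsAt x ((c.val : ℤ) + 1)).ncard

theorem IsPeriodic.exists_max {k : ℕ} {x : Equiv.Perm ℤ} (hx : IsPeriodic k x) :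
    ∃ j : ℤ, ∀ i, x i - i ≤ x j - j := by
  obtain ⟨c, hc⟩ := Finite.exists_max fun c : ZMod (k + 1) => x (c.val : ℤ) - (c.val : ℤ)
  refine ⟨c.val, fun i => ?_⟩
  rw [hx.apply_sub_eq (intCast_val (i : ZMod (k + 1))).symm]
  exact hc i

/-- The displacement `x i - i` is bounded above, so a position with a value above `x j` cannot lie
too far to the left. Finiteness keeps `ncard` from taking its default value 0. -/
theorem IsPeriodic.finite_inversionsAt {k : ℕ} {x : Equiv.Perm ℤ} (hx : IsPeriodic k x) (j : ℤ) :
    (inversionsAt x j).Finite := by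
  obtain ⟨m, hm⟩ := hx.exists_max
  refine (Set.finite_Ioo (x j - (x m - m)) j).subset ?_
  rintro i ⟨h1, h2⟩
  have := hm i
  exact ⟨by linarith, h1⟩

theorem IsPeriodic.code_intCast {k : ℕ} {x : Equiv.Perm ℤ} (hx : IsPeriodic k x) (m : ℤ) :
    code k x (m : ZMod (k + 1)) = (inversionsAt x (m + 1)).ncard := by
  obtain ⟨t, ht⟩ := exists_eq_add_mul (intCast_val (m : ZMod (k + 1)))
  rw [code, ht]
  rw [← Set.ncard_image_of_injective (inversionsAt x (m + 1))
    (add_left_injective (t * ((k : ℤ) + 1)))]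
  congr 1
  ext i
  have h1 := hx.apply_add_mul (m + 1) t
  have h2 := hx.apply_add_mul (i - t * (k + 1)) t
  rw [sub_add_cancel] at h2
  simp only [inversionsAt, Set.mem_ofPred_eq, Set.mem_image]
  rw [show m + t * ((k : ℤ) + 1) + 1 = m + 1 + t * (k + 1) by ring, h1, h2]
  constructor
  · rintro ⟨h3, h4⟩
    exact ⟨i - t * (k + 1), ⟨by linarith, by linarith⟩, by ring⟩
  · rintro ⟨a, ⟨h3, h4⟩, rfl⟩
    rw [add_sub_cancel_right]
    exact ⟨by linarith, by linarith⟩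

theorem IsPeriodic.mem_rightDescents_intCast {k : ℕ} {x : Equiv.Perm ℤ} (hx : IsPeriodic k x)
    (m : ℤ) : (m : ZMod (k + 1)) ∈ rightDescents k x ↔ x (m + 1) < x m := by
  obtain ⟨t, ht⟩ := exists_eq_add_mul (intCast_val (m : ZMod (k + 1)))
  rw [rightDescents, Set.mem_ofPred_eq, ht, show m + t * ((k : ℤ) + 1) + 1 = m + 1 + t * (k + 1) by
    ring, hx.apply_add_mul, hx.apply_add_mul]
  exact add_lt_add_iff_right _

/-- If `x (m + 1) < x m`, each inversion ending at `m` gives one ending at `m + 1`, and `m` itself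
is a new one. Otherwise the inclusion is reversed. -/
theorem IsPeriodic.mem_rightDescents_iff {k : ℕ} {x : Equiv.Perm ℤ} (hx : IsPeriodic k x)
    (r : ZMod (k + 1)) : r ∈ rightDescents k x ↔ code k x (r - 1) < code k x r := by
  obtain ⟨m, rfl⟩ := ZMod.intCast_surjective r
  have h1 : (m : ZMod (k + 1)) - 1 = ((m - 1 : ℤ) : ZMod (k + 1)) := by push_cast; ring
  rw [hx.mem_rightDescents_intCast, h1, hx.code_intCast, hx.code_intCast, sub_add_cancel]
  constructor
  · intro h
    refine Set.ncard_lt_ncard ⟨?_, fun hs => ?_⟩ (hx.finite_inversionsAt _)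
    · rintro i ⟨h2, h3⟩
      exact ⟨by linarith, by linarith⟩
    · exact lt_irrefl _ (hs (show m ∈ inversionsAt x (m + 1) from ⟨by linarith, h⟩)).1
  · intro h
    by_contra h2
    refine absurd (Set.ncard_le_ncard ?_ (hx.finite_inversionsAt m)) (not_le.2 h)
    rintro i ⟨h3, h4⟩
    have h5 : i ≠ m := by
      rintro rfl
      exact h2 h4
    exact ⟨by omega, by linarith⟩

/-- At a position of maximal displacement no larger value stands to the left. -/
theorem IsPeriodic.exists_code_eq_zero {k : ℕ} {x : Equiv.Perm ℤ} (hx : IsPeriodic k x) :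
    ∃ c, code k x c = 0 := by
  obtain ⟨j, hj⟩ := hx.exists_max
  refine ⟨((j - 1 : ℤ) : ZMod (k + 1)), ?_⟩
  rw [hx.code_intCast, sub_add_cancel, Set.ncard_eq_zero (hx.finite_inversionsAt j)]
  refine Set.eq_empty_iff_forall_notMem.2 ?_
  rintro i ⟨h1, h2⟩
  have := hj i
  linarith

theorem ncard_inversionsAt_mul (x s : Equiv.Perm ℤ) (j : ℤ) :
    (inversionsAt (x * s) j).ncard = {i | s.symm i < j ∧ x (s j) < x i}.ncard := by
  rw [← Set.ncard_image_of_injective _ s.injective]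
  congr 1
  ext i
  simp only [inversionsAt, Set.mem_image, Set.mem_ofPred_eq, Equiv.Perm.mul_apply]
  constructor
  · rintro ⟨a, ⟨h1, h2⟩, rfl⟩
    simpa using ⟨h1, h2⟩
  · rintro ⟨h1, h2⟩
    exact ⟨s.symm i, ⟨h1, by simpa using h2⟩, by simp⟩

theorem self_ne_sub_one {k : ℕ} [NeZero k] (r : ZMod (k + 1)) : r ≠ r - 1 := by
  have : Fact (1 < k + 1) := ⟨by have := Nat.pos_of_ne_zero (NeZero.ne k); omega⟩
  intro h
  exact one_ne_zero (α := ZMod (k + 1)) (by linear_combination h)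

/-- Values at `m` and `m + 1` trade places and take their inversions along; only the inversion
between these two disappears. The correction is written on the left to avoid truncated subtraction.
-/
theorem code_mul_simpleRefl {k : ℕ} [NeZero k] {x : Equiv.Perm ℤ} (hx : IsPeriodic k x)
    {r : ZMod (k + 1)} (hr : r ∈ rightDescents k x) (c : ZMod (k + 1)) :
    code k (x * simpleRefl k r) c + (if c = r - 1 then 1 else 0) =
      code k x (Equiv.swap r (r - 1) c) := by
  have hne := self_ne_sub_one r
  have hy := hx.mul (isPeriodic_simpleRefl r)
  obtain ⟨m, rfl⟩ := ZMod.intCast_surjective r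
  have h1 : (m : ZMod (k + 1)) - 1 = ((m - 1 : ℤ) : ZMod (k + 1)) := by push_cast; ring
  rw [hx.mem_rightDescents_intCast] at hr
  have hs : ∀ i, (simpleRefl k (m : ZMod (k + 1))).symm i = simpleRefl k (m : ZMod (k + 1)) i :=
    fun i => rfl
  have hsm : simpleRefl k (m : ZMod (k + 1)) m = m + 1 := by simp [simpleRefl_apply]
  have hsm1 : simpleRefl k (m : ZMod (k + 1)) (m + 1) = m := by
    rw [← hsm]; exact simpleFun_involutive k _ m
  -- The half-line below `j` is stable under `s_m` unless the pair `j - 1`, `j` is itself exchanged.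
  have hlt : ∀ j : ℤ, ((j - 1 : ℤ) : ZMod (k + 1)) ≠ m → ∀ i,
      simpleRefl k (m : ZMod (k + 1)) i < j ↔ i < j := by
    intro j hj i
    rw [simpleRefl_apply]
    split_ifs with h2 h3
    · have : i ≠ j - 1 := by
        rintro rfl
        exact hj h2
      omega
    · have : i ≠ j := by
        rintro rfl
        refine hj ?_
        push_cast
        rw [h3]; ring
      omega
    · rfl
  by_cases hc1 : c = (m : ZMod (k + 1)) - 1
  · rw [if_pos hc1, hc1, Equiv.swap_apply_right, h1, hy.code_intCast, hx.code_intCast,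
      sub_add_cancel, ncard_inversionsAt_mul, hsm]
    have hm : m ∉ {i | (simpleRefl k (m : ZMod (k + 1))).symm i < m ∧ x (m + 1) < x i} := by
      rintro ⟨h2, -⟩
      rw [hs, hsm] at h2
      omega
    have hlt' := hlt m (by rw [← h1]; exact hne.symm)
    have hfin : {i | (simpleRefl k (m : ZMod (k + 1))).symm i < m ∧ x (m + 1) < x i}.Finite := by
      refine (hx.finite_inversionsAt (m + 1)).subset ?_
      rintro i ⟨h2, h3⟩
      rw [hs, hlt'] at h2
      exact ⟨by omega, h3⟩
    rw [← Set.ncard_insert_of_notMem hm hfin]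
    congr 1
    ext i
    simp only [Set.mem_insert_iff, Set.mem_ofPred_eq, inversionsAt, hs]
    rw [hlt']
    constructor
    · rintro (rfl | ⟨h2, h3⟩)
      · exact ⟨by omega, hr⟩
      · exact ⟨by omega, h3⟩
    · rintro ⟨h2, h3⟩
      rcases (show i = m ∨ i < m by omega) with h4 | h4
      · exact Or.inl h4
      · exact Or.inr ⟨h4, h3⟩
  · rw [if_neg hc1, add_zero]
    by_cases hc2 : c = (m : ZMod (k + 1))
    · rw [hc2, Equiv.swap_apply_left, h1, hy.code_intCast, hx.code_intCast,
        sub_add_cancel, ncard_inversionsAt_mul, hsm1]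
      congr 1
      ext i
      simp only [inversionsAt, Set.mem_ofPred_eq, hs]
      have h2 : simpleRefl k (m : ZMod (k + 1)) i < m ↔ i < m :=
        hlt m (by rw [← h1]; exact hne.symm) i
      have h3 : simpleRefl k (m : ZMod (k + 1)) i = m ↔ i = m + 1 := by
        conv_lhs => rhs; rw [← hsm1]
        exact (simpleRefl k (m : ZMod (k + 1))).apply_eq_iff_eq
      constructor
      · rintro ⟨h4, h5⟩
        refine ⟨?_, h5⟩
        rcases (show simpleRefl k (m : ZMod (k + 1)) i < m ∨
          simpleRefl k (m : ZMod (k + 1)) i = m by omega) with h6 | h6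
        · exact h2.1 h6
        · rw [h3] at h6
          subst h6
          exact absurd h5 (not_lt.2 hr.le)
      · rintro ⟨h4, h5⟩
        exact ⟨by have := h2.2 h4; omega, h5⟩
    · rw [Equiv.swap_apply_of_ne_of_ne hc2 hc1]
      obtain ⟨n, rfl⟩ := ZMod.intCast_surjective c
      rw [hy.code_intCast, hx.code_intCast, ncard_inversionsAt_mul]
      have h2 : simpleRefl k (m : ZMod (k + 1)) (n + 1) = n + 1 := by
        rw [simpleRefl_apply, if_neg, if_neg]
        · push_cast
          intro h
          exact hc2 (add_right_cancel h)
        · push_cast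
          intro h
          exact hc1 (by rw [← h]; ring)
      rw [h2]
      congr 1
      ext i
      simp only [inversionsAt, Set.mem_ofPred_eq, hs]
      rw [hlt (n + 1) (by rwa [add_sub_cancel_right])]

theorem mem_rightDescents_mul_simpleRefl {k : ℕ} [NeZero k] {x : Equiv.Perm ℤ}
    (hx : IsPeriodic k x) (r : ZMod (k + 1)) :
    r ∈ rightDescents k (x * simpleRefl k r) ↔ r ∉ rightDescents k x := by
  have hy := hx.mul (isPeriodic_simpleRefl r)
  obtain ⟨m, rfl⟩ := ZMod.intCast_surjective r
  have hsm : simpleRefl k (m : ZMod (k + 1)) m = m + 1 := by simp [simpleRefl_apply]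
  have hsm1 : simpleRefl k (m : ZMod (k + 1)) (m + 1) = m := by
    rw [← hsm]; exact simpleFun_involutive k _ m
  rw [hx.mem_rightDescents_intCast, hy.mem_rightDescents_intCast, Equiv.Perm.mul_apply,
    Equiv.Perm.mul_apply, hsm, hsm1, not_lt]
  have : x m ≠ x (m + 1) := fun h => by have := x.injective h; omega
  omega

theorem code_mul_simpleRefl_of_notMem {k : ℕ} [NeZero k] {x : Equiv.Perm ℤ} (hx : IsPeriodic k x)
    {r : ZMod (k + 1)} (hr : r ∉ rightDescents k x) (c : ZMod (k + 1)) :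
    code k (x * simpleRefl k r) c =
      code k x (Equiv.swap r (r - 1) c) + (if c = r then 1 else 0) := by
  have h := code_mul_simpleRefl (hx.mul (isPeriodic_simpleRefl r))
    ((mem_rightDescents_mul_simpleRefl hx r).2 hr) (Equiv.swap r (r - 1) c)
  rw [mul_assoc, simpleRefl_mul_self, mul_one, Equiv.swap_apply_self] at h
  rw [← h]
  congr 2
  rw [Equiv.swap_apply_eq_iff, Equiv.swap_apply_right]

theorem code_mul_simpleRefl_of_ne {k : ℕ} [NeZero k] {x : Equiv.Perm ℤ} (hx : IsPeriodic k x)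
    {r c : ZMod (k + 1)} (h1 : c ≠ r) (h2 : c ≠ r - 1) :
    code k (x * simpleRefl k r) c = code k x c := by
  by_cases hr : r ∈ rightDescents k x
  · simpa [h1, h2, Equiv.swap_apply_of_ne_of_ne] using code_mul_simpleRefl hx hr c
  · simpa [h1, h2, Equiv.swap_apply_of_ne_of_ne] using code_mul_simpleRefl_of_notMem hx hr c

theorem code_one (k : ℕ) (c : ZMod (k + 1)) : code k 1 c = 0 := by
  rw [code, Set.ncard_eq_zero ((isPeriodic_one k).finite_inversionsAt _)]
  refine Set.eq_empty_iff_forall_notMem.2 ?_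
  rintro i ⟨h1, h2⟩
  exact lt_asymm h1 h2

/-! ### The number of inversions -/

/-- The affine inversion number. -/
noncomputable def invNumber (k : ℕ) (x : Equiv.Perm ℤ) : ℕ :=
  ∑ c : ZMod (k + 1), code k x c

theorem invNumber_mul_simpleRefl {k : ℕ} [NeZero k] {x : Equiv.Perm ℤ} (hx : IsPeriodic k x)
    {r : ZMod (k + 1)} (hr : r ∈ rightDescents k x) :
    invNumber k (x * simpleRefl k r) + 1 = invNumber k x := by
  have h := Finset.sum_congr (rfl : (Finset.univ : Finset (ZMod (k + 1))) = Finset.univ)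
    fun c _ => code_mul_simpleRefl hx hr c
  rw [Finset.sum_add_distrib, Finset.sum_ite_eq', if_pos (Finset.mem_univ _),
    Equiv.sum_comp (Equiv.swap r (r - 1)) (code k x)] at h
  exact h

theorem invNumber_mul_simpleRefl_of_notMem {k : ℕ} [NeZero k] {x : Equiv.Perm ℤ}
    (hx : IsPeriodic k x) {r : ZMod (k + 1)} (hr : r ∉ rightDescents k x) :
    invNumber k (x * simpleRefl k r) = invNumber k x + 1 := by
  have h := invNumber_mul_simpleRefl (hx.mul (isPeriodic_simpleRefl r))
    ((mem_rightDescents_mul_simpleRefl hx r).2 hr)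
  rw [mul_assoc, simpleRefl_mul_self, mul_one] at h
  exact h.symm

theorem invNumber_mul_wordProd_le {k : ℕ} [NeZero k] {x : Equiv.Perm ℤ} (hx : IsPeriodic k x)
    (w : List (ZMod (k + 1))) : invNumber k (x * wordProd k w) ≤ invNumber k x + w.length := by
  induction w using List.reverseRecOn with
  | nil => simp [wordProd]
  | append_singleton w r ih =>
    have hy := hx.mul (isPeriodic_wordProd w)
    rw [wordProd_append, wordProd_singleton, ← mul_assoc, List.length_append, List.length_singleton]
    by_cases hr : r ∈ rightDescents k (x * wordProd k w)
    · have := invNumber_mul_simpleRefl hy hr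
      omega
    · have := invNumber_mul_simpleRefl_of_notMem hy hr
      omega

theorem invNumber_le_mul_wordProd {k : ℕ} [NeZero k] {x : Equiv.Perm ℤ} (hx : IsPeriodic k x)
    (w : List (ZMod (k + 1))) : invNumber k x ≤ invNumber k (x * wordProd k w) + w.length := by
  have h := invNumber_mul_wordProd_le (hx.mul (isPeriodic_wordProd w)) w.reverse
  rwa [mul_assoc, wordProd_mul_wordProd_reverse, mul_one, List.length_reverse] at h

theorem invNumber_one (k : ℕ) : invNumber k 1 = 0 :=
  Finset.sum_eq_zero fun c _ => code_one k c

theorem invNumber_wordProd_le {k : ℕ} [NeZero k] (w : List (ZMod (k + 1))) :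
    invNumber k (wordProd k w) ≤ w.length := by
  simpa [invNumber_one] using invNumber_mul_wordProd_le (isPeriodic_one k) w

/-- If removing the letters of a word one by one lowers the inversion number by the length of the
word, then every single letter is a descent. -/
theorem mem_rightDescents_of_invNumber {k : ℕ} [NeZero k] {x : Equiv.Perm ℤ} (hx : IsPeriodic k x)
    {v w : List (ZMod (k + 1))} {r : ZMod (k + 1)}
    (h : invNumber k (x * wordProd k (v ++ r :: w)) + (v ++ r :: w).length = invNumber k x) :
    r ∈ rightDescents k (x * wordProd k v) := by
  by_contra hr
  have hy := hx.mul (isPeriodic_wordProd v)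
  have h1 := invNumber_mul_simpleRefl_of_notMem hy hr
  have h2 := invNumber_le_mul_wordProd hx v
  have h3 := invNumber_le_mul_wordProd (hy.mul (isPeriodic_simpleRefl r)) w
  rw [wordProd_append, ← List.singleton_append, wordProd_append, wordProd_singleton,
    ← mul_assoc, ← mul_assoc] at h
  simp only [List.length_append, List.length_singleton] at h
  omega

/-! ### Elements without inversions -/

/-- The total displacement over one period. -/
def displacement (k : ℕ) (x : Equiv.Perm ℤ) : ℤ :=
  ∑ c : ZMod (k + 1), (x (c.val : ℤ) - (c.val : ℤ))

/-- `y` permutes the residues, and `x i - i` depends only on the residue of `i`. -/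
theorem displacement_mul {k : ℕ} {x y : Equiv.Perm ℤ} (hx : IsPeriodic k x) (hy : IsPeriodic k y) :
    displacement k (x * y) = displacement k x + displacement k y := by
  have hinj : Function.Injective
      fun c : ZMod (k + 1) => ((y (c.val : ℤ) : ℤ) : ZMod (k + 1)) := by
    intro a b hab
    obtain ⟨t, ht⟩ := exists_eq_add_mul hab
    rw [← hy.apply_add_mul] at ht
    have h1 := congrArg (Int.cast : ℤ → ZMod (k + 1)) (y.injective ht)
    push_cast at h1
    simpa [natCast_succ_self] using h1
  have h := (Finite.injective_iff_bijective.1 hinj).sum_comp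
    fun c : ZMod (k + 1) => x (c.val : ℤ) - (c.val : ℤ)
  rw [displacement, displacement, displacement, ← h, ← Finset.sum_add_distrib]
  refine Finset.sum_congr rfl fun c _ => ?_
  rw [hx.apply_sub_eq (intCast_val ((y (c.val : ℤ) : ℤ) : ZMod (k + 1))), Equiv.Perm.mul_apply]
  ring

theorem displacement_wordProd {k : ℕ} [NeZero k] (w : List (ZMod (k + 1))) :
    displacement k (wordProd k w) = 0 := by
  induction w with
  | nil => simp [wordProd, displacement]
  | cons r w ih =>
    have hr := displacement_mul (isPeriodic_simpleRefl r) (isPeriodic_simpleRefl r)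
    have h1 : displacement k 1 = 0 := by simp [displacement]
    rw [simpleRefl_mul_self, h1] at hr
    rw [← List.singleton_append, wordProd_append, wordProd_singleton,
      displacement_mul (isPeriodic_simpleRefl r) (isPeriodic_wordProd w), ih]
    omega

/-- Without inversions `x` is an increasing bijection of `ℤ`, hence a translation; zero displacement
excludes the nontrivial ones. -/
theorem eq_one_of_invNumber_eq_zero {k : ℕ} {x : Equiv.Perm ℤ} (hx : IsPeriodic k x)
    (hd : displacement k x = 0) (h : invNumber k x = 0) : x = 1 := by
  have hc : ∀ c, code k x c = 0 := fun c => (Finset.sum_eq_zero_iff.1 h) c (Finset.mem_univ c)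
  have hlt : ∀ i : ℤ, x i < x (i + 1) := by
    intro i
    have h1 : ¬ (x (i + 1) < x i) := by
      rw [← hx.mem_rightDescents_intCast, hx.mem_rightDescents_iff, hc, hc]
      exact lt_irrefl 0
    have : x i ≠ x (i + 1) := fun h => by have := x.injective h; omega
    omega
  have hmono : StrictMono x := strictMono_int_of_lt_succ hlt
  have hsucc : ∀ i : ℤ, x (i + 1) = x i + 1 := by
    intro i
    obtain ⟨j, hj⟩ := x.surjective (x i + 1)
    have h1 : i < j := hmono.lt_iff_lt.1 (by omega)
    have h2 : x (i + 1) ≤ x j := hmono.monotone (by omega)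
    have := hlt i
    omega
  have hshift : ∀ i : ℤ, x i - i = x 0 := by
    intro i
    induction i using Int.induction_on with
    | zero => simp
    | succ n ih => rw [hsucc]; omega
    | pred n ih =>
      have := hsucc (-(n : ℤ) - 1)
      rw [sub_add_cancel] at this
      omega
  have h0 : x 0 = 0 := by
    simp only [displacement, hshift, Finset.sum_const, Finset.card_univ, ZMod.card,
      nsmul_eq_mul] at hd
    rcases mul_eq_zero.1 hd with h1 | h1
    · exact absurd h1 (by positivity)
    · exact h1
  ext i
  have := hshift i
  rw [Equiv.Perm.one_apply]
  omega


/-! ### Cyclically decreasing elements -/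

theorem exists_decreasingWord_eq {k : ℕ} {A : Finset (ZMod (k + 1))} {a : ZMod (k + 1)}
    (ha : a ∉ A) : ∃ m ∉ A, decreasingWord k A =
      ((List.range k).map (fun t : ℕ => m - 1 - (t : ZMod (k + 1)))).filter (· ∈ A) := by
  have h : ∃ m, m ∉ A := ⟨a, ha⟩
  refine ⟨h.choose, h.choose_spec, ?_⟩
  rw [decreasingWord, dif_pos h]

theorem length_decreasingWord {k : ℕ} {A : Finset (ZMod (k + 1))} (hA : A ≠ Finset.univ) :
    (decreasingWord k A).length = A.card := by
  obtain ⟨h1, h2, -⟩ := isCyclicallyDecreasingWord_decreasingWord k A hA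
  rw [← List.toFinset_card_of_nodup h1, h2]

/-- The first `t` letters of the increasing word with letters in `A`, read from `m + 1` on. -/
def increasingPrefix {k : ℕ} (A : Finset (ZMod (k + 1))) (m : ZMod (k + 1)) (t : ℕ) :
    List (ZMod (k + 1)) :=
  ((List.range t).map (fun u : ℕ => m + 1 + (u : ZMod (k + 1)))).filter (· ∈ A)

theorem increasingPrefix_succ {k : ℕ} (A : Finset (ZMod (k + 1))) (m : ZMod (k + 1)) (t : ℕ) :
    increasingPrefix A m (t + 1) = increasingPrefix A m t ++
      if m + 1 + (t : ZMod (k + 1)) ∈ A then [m + 1 + (t : ZMod (k + 1))] else [] := by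
  rw [increasingPrefix, List.range_succ, List.map_append, List.filter_append]
  congr 1
  simp [List.filter_singleton]

theorem exists_reverse_decreasingWord_eq {k : ℕ} {A : Finset (ZMod (k + 1))}
    (hA : A ≠ Finset.univ) :
    ∃ m ∉ A, (decreasingWord k A).reverse = increasingPrefix A m k := by
  obtain ⟨a, ha⟩ : ∃ a, a ∉ A := by
    by_contra! hc
    exact hA (Finset.eq_univ_iff_forall.2 hc)
  obtain ⟨m, hm, h⟩ := exists_decreasingWord_eq ha
  refine ⟨m, hm, ?_⟩
  rw [h, ← List.filter_reverse, ← List.map_reverse, increasingPrefix, List.range_eq_range',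
    List.reverse_range', List.map_map, ← List.range_eq_range']
  congr 1
  refine List.map_congr_left fun u hu => ?_
  rw [List.mem_range] at hu
  have h1 : 0 + k - 1 - u + (u + 1) = k := by omega
  have h2 := congrArg (Nat.cast : ℕ → ZMod (k + 1)) h1
  push_cast at h2
  have h3 := natCast_succ_self k
  simp only [Function.comp_apply]
  linear_combination -h2 - h3

theorem increasingPrefix_add {k : ℕ} (A : Finset (ZMod (k + 1))) (m : ZMod (k + 1)) (s t : ℕ) :
    ∃ w, increasingPrefix A m (s + t) = increasingPrefix A m s ++ w := by
  rw [increasingPrefix, List.range_add, List.map_append, List.filter_append]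
  exact ⟨_, rfl⟩

/-- The first `t` letters are among `m + 1, ..., m + t` and touch only the columns `m, ..., m + t`.
-/
theorem code_mul_increasingPrefix_of_lt {k : ℕ} [NeZero k] {x : Equiv.Perm ℤ}
    (hx : IsPeriodic k x) (A : Finset (ZMod (k + 1))) (m : ZMod (k + 1)) {t u : ℕ}
    (htu : t < u) (hu : u ≤ k) :
    code k (x * wordProd k (increasingPrefix A m t)) (m + u) = code k x (m + u) := by
  induction t with
  | zero => simp [increasingPrefix, wordProd]
  | succ t ih =>
    have ih := ih (by omega)
    rw [increasingPrefix_succ]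
    split_ifs with h
    · rw [wordProd_append, wordProd_singleton, ← mul_assoc,
        code_mul_simpleRefl_of_ne (hx.mul (isPeriodic_wordProd _)), ih]
      · intro h1
        have := natCast_inj_of_le (k := k) hu (show t + 1 ≤ k by omega)
          (by push_cast; linear_combination h1)
        omega
      · intro h1
        have := natCast_inj_of_le (k := k) hu (show t ≤ k by omega)
          (by linear_combination h1)
        omega
    · rw [List.append_nil, ih]

/-- When the letter `r` is removed it is a descent, so column `r` is then higher than its left
neighbour; the earlier letters have left column `r` unchanged. -/
theorem code_pos_of_invNumber {k : ℕ} [NeZero k] {x : Equiv.Perm ℤ} (hx : IsPeriodic k x)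
    {B : Finset (ZMod (k + 1))} (hB : B ≠ Finset.univ)
    (h : invNumber k (x * wordProd k (decreasingWord k B).reverse) + B.card = invNumber k x)
    {r : ZMod (k + 1)} (hr : r ∈ B) : 0 < code k x r := by
  rw [← length_decreasingWord hB, ← List.length_reverse] at h
  obtain ⟨m, hm, hw⟩ := exists_reverse_decreasingWord_eq hB
  rw [hw] at h
  obtain ⟨u, hu, hur⟩ := exists_natCast_eq (r - m)
  obtain rfl : r = m + u := by rw [hur]; ring
  obtain ⟨t, rfl⟩ : ∃ t, u = t + 1 := by
    refine ⟨u - 1, ?_⟩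
    rcases Nat.eq_zero_or_pos u with rfl | h0
    · exact absurd (by simpa using hr) hm
    · omega
  have hr' : m + 1 + (t : ZMod (k + 1)) = m + ((t + 1 : ℕ) : ZMod (k + 1)) := by push_cast; ring
  obtain ⟨w, hw'⟩ := increasingPrefix_add B m (t + 1) (k - (t + 1))
  rw [show t + 1 + (k - (t + 1)) = k by omega, increasingPrefix_succ, hr', if_pos hr,
    List.append_assoc, List.singleton_append] at hw'
  rw [hw'] at h
  have h1 := mem_rightDescents_of_invNumber hx h
  rw [(hx.mul (isPeriodic_wordProd _)).mem_rightDescents_iff,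
    code_mul_increasingPrefix_of_lt hx B m (Nat.lt_succ_self t) hu] at h1
  exact Nat.zero_lt_of_lt h1

/-! ### Splitting off the support of the code -/

/-- The support of the Lehmer code. -/
noncomputable def codeSupport (k : ℕ) (x : Equiv.Perm ℤ) : Finset (ZMod (k + 1)) :=
  Finset.univ.filter fun c => 0 < code k x c

theorem mem_codeSupport {k : ℕ} {x : Equiv.Perm ℤ} {c : ZMod (k + 1)} :
    c ∈ codeSupport k x ↔ 0 < code k x c := by
  simp [codeSupport]

theorem IsPeriodic.codeSupport_ne_univ {k : ℕ} {x : Equiv.Perm ℤ} (hx : IsPeriodic k x) :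
    codeSupport k x ≠ Finset.univ := by
  obtain ⟨c, hc⟩ := hx.exists_code_eq_zero
  intro h
  have := mem_codeSupport.1 (h ▸ Finset.mem_univ c)
  omega

/-- An empty column travels from `m` to `m + t`. Each nonzero column it meets forms a descent with
it, so the two are exchanged and a box is lost; meeting an empty column needs no letter, in
agreement with truncated `0 - 1 = 0`. -/
theorem code_mul_increasingPrefix_codeSupport {k : ℕ} [NeZero k] {x : Equiv.Perm ℤ}
    (hx : IsPeriodic k x) {m : ZMod (k + 1)} (hm : m ∉ codeSupport k x) {t : ℕ} (ht : t ≤ k) :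
    (∀ u : ℕ, u < t → code k (x * wordProd k (increasingPrefix (codeSupport k x) m t)) (m + u) =
      code k x (m + u + 1) - 1) ∧
    code k (x * wordProd k (increasingPrefix (codeSupport k x) m t)) (m + t) = 0 := by
  induction t with
  | zero =>
    rw [mem_codeSupport] at hm
    simpa [increasingPrefix, wordProd] using hm
  | succ t ih =>
    obtain ⟨ih1, ih2⟩ := ih (by omega)
    have h3 := code_mul_increasingPrefix_of_lt hx (codeSupport k x) m (Nat.lt_succ_self t) ht
    rw [increasingPrefix_succ]
    have hy := hx.mul (isPeriodic_wordProd (increasingPrefix (codeSupport k x) m t))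
    set y := x * wordProd k (increasingPrefix (codeSupport k x) m t) with hy_def
    have e1 : m + ((t + 1 : ℕ) : ZMod (k + 1)) = m + t + 1 := by push_cast; ring
    have e2 : m + 1 + (t : ZMod (k + 1)) = m + t + 1 := by ring
    rw [e1] at h3 ⊢
    rw [e2]
    split_ifs with h
    · rw [wordProd_append, wordProd_singleton, ← mul_assoc, ← hy_def]
      rw [mem_codeSupport] at h
      have hr : m + t + 1 ∈ rightDescents k y := by
        rw [hy.mem_rightDescents_iff, add_sub_cancel_right, ih2, h3]
        exact h
      have hs := code_mul_simpleRefl hy hr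
      rw [add_sub_cancel_right] at hs
      constructor
      · intro u hu
        rcases Nat.lt_succ_iff_lt_or_eq.1 hu with hu | rfl
        · rw [← ih1 u hu, code_mul_simpleRefl_of_ne hy]
          · intro h1
            have := natCast_inj_of_le (k := k) (show u ≤ k by omega) ht
              (by push_cast; linear_combination h1)
            omega
          · rw [add_sub_cancel_right]
            intro h1
            have := natCast_inj_of_le (k := k) (show u ≤ k by omega) (show t ≤ k by omega)
              (by linear_combination h1)
            omega
        · have := hs (m + u)
          rw [if_pos rfl, Equiv.swap_apply_right, h3] at this
          omega
      · have := hs (m + t + 1)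
        rw [Equiv.swap_apply_left, ih2] at this
        omega
    · rw [List.append_nil, ← hy_def]
      rw [mem_codeSupport, not_lt, Nat.le_zero] at h
      constructor
      · intro u hu
        rcases Nat.lt_succ_iff_lt_or_eq.1 hu with hu | rfl
        · exact ih1 u hu
        · rw [ih2, h]
      · rw [h3, h]

theorem code_mul_reverse_codeSupport {k : ℕ} [NeZero k] {x : Equiv.Perm ℤ}
    (hx : IsPeriodic k x) (c : ZMod (k + 1)) :
    code k (x * wordProd k (decreasingWord k (codeSupport k x)).reverse) c =
      code k x (c + 1) - 1 := by
  obtain ⟨m, hm, hw⟩ := exists_reverse_decreasingWord_eq hx.codeSupport_ne_univ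
  obtain ⟨h1, h2⟩ := code_mul_increasingPrefix_codeSupport hx hm le_rfl
  rw [hw]
  obtain ⟨u, hu, huc⟩ := exists_natCast_eq (c - m)
  obtain rfl : c = m + u := by rw [huc]; ring
  rcases hu.lt_or_eq with hu | rfl
  · exact h1 u hu
  -- The cycle closes here: `m + k + 1 = m`, whose column is empty.
  · rw [mem_codeSupport, not_lt, Nat.le_zero] at hm
    rw [h2, add_assoc, natCast_succ_self, add_zero, hm]

theorem invNumber_mul_reverse_codeSupport {k : ℕ} [NeZero k] {x : Equiv.Perm ℤ}
    (hx : IsPeriodic k x) :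
    invNumber k (x * wordProd k (decreasingWord k (codeSupport k x)).reverse) +
      (codeSupport k x).card = invNumber k x := by
  have h1 : (codeSupport k x).card = ∑ c, if 0 < code k x c then 1 else 0 :=
    Finset.card_filter _ _
  have h2 := Equiv.sum_comp (Equiv.addRight (1 : ZMod (k + 1))) fun c => code k x c - 1
  rw [invNumber, invNumber, h1,
    Finset.sum_congr rfl fun c _ => code_mul_reverse_codeSupport hx c]
  refine (congrArg (· + _) h2).trans ?_
  rw [← Finset.sum_add_distrib]
  refine Finset.sum_congr rfl fun c _ => ?_
  split_ifs <;> omega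

/-! ### Code and descents of a cyclically decreasing element -/

/-- In decreasing order each new letter `r` finds columns `r` and `r - 1` both empty, so it only
adds one box in column `r`. -/
theorem code_wordProd_prefix {k : ℕ} [NeZero k] (A : Finset (ZMod (k + 1))) (m : ZMod (k + 1))
    {t u : ℕ} (ht : t ≤ k) (hu : u ≤ k) :
    code k (wordProd k (((List.range t).map
      (fun v : ℕ => m - 1 - (v : ZMod (k + 1)))).filter (· ∈ A))) (m - 1 - u) =
      if u < t ∧ m - 1 - (u : ZMod (k + 1)) ∈ A then 1 else 0 := by
  induction t generalizing u with
  | zero => simp [wordProd, code_one]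
  | succ t ih =>
    rw [List.range_succ, List.map_append, List.filter_append, wordProd_append]
    set y := wordProd k (((List.range t).map
      (fun v : ℕ => m - 1 - (v : ZMod (k + 1)))).filter (· ∈ A)) with hy_def
    have hy : IsPeriodic k y := isPeriodic_wordProd _
    have ih : ∀ {u : ℕ}, u ≤ k → code k y (m - 1 - u) =
      if u < t ∧ m - 1 - (u : ZMod (k + 1)) ∈ A then 1 else 0 := ih (by omega)
    have e : m - 1 - (t : ZMod (k + 1)) - 1 = m - 1 - ((t + 1 : ℕ) : ZMod (k + 1)) := by
      push_cast; ring
    have h0 : code k y (m - 1 - t) = 0 := by rw [ih (by omega)]; simp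
    have h1 : code k y (m - 1 - (t : ZMod (k + 1)) - 1) = 0 := by rw [e, ih ht]; simp
    by_cases hA : m - 1 - (t : ZMod (k + 1)) ∈ A
    · rw [List.map_singleton, List.filter_cons_of_pos (by simpa using hA), List.filter_nil,
        wordProd_singleton]
      have hr : m - 1 - (t : ZMod (k + 1)) ∉ rightDescents k y := by
        rw [hy.mem_rightDescents_iff, h0, h1]
        exact lt_irrefl 0
      have hs := code_mul_simpleRefl_of_notMem hy hr
      by_cases hut : u = t
      · subst hut
        rw [hs, Equiv.swap_apply_left, h1, if_pos rfl, if_pos ⟨Nat.lt_succ_self _, hA⟩]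
      · by_cases hut1 : u = t + 1
        · subst hut1
          have hne := (self_ne_sub_one (m - 1 - (t : ZMod (k + 1)))).symm
          rw [← e, hs, Equiv.swap_apply_right, h0, if_neg hne, if_neg (by simp)]
        · rw [code_mul_simpleRefl_of_ne hy, ih hu]
          · congr 1
            rw [show (u < t + 1) = (u < t) by apply propext; omega]
          · intro h
            exact hut (natCast_inj_of_le (k := k) hu (by omega) (by linear_combination -h))
          · intro h
            exact hut1 (natCast_inj_of_le (k := k) hu ht (by push_cast; linear_combination -h))
    · rw [List.map_singleton, List.filter_cons_of_neg (by simpa using hA), List.filter_nil,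
        show wordProd k ([] : List (ZMod (k + 1))) = 1 from rfl, mul_one, ih hu]
      congr 1
      apply propext
      constructor
      · rintro ⟨h2, h3⟩
        exact ⟨by omega, h3⟩
      · rintro ⟨h2, h3⟩
        have : u ≠ t := by
          rintro rfl
          exact hA h3
        exact ⟨by omega, h3⟩

theorem code_decreasingElt {k : ℕ} [NeZero k] {A : Finset (ZMod (k + 1))}
    (hA : A ≠ Finset.univ) (c : ZMod (k + 1)) :
    code k (decreasingElt k A) c = if c ∈ A then 1 else 0 := by
  obtain ⟨a, ha⟩ : ∃ a, a ∉ A := by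
    by_contra! hc
    exact hA (Finset.eq_univ_iff_forall.2 hc)
  obtain ⟨m, hm, h⟩ := exists_decreasingWord_eq ha
  obtain ⟨u, hu, huc⟩ := exists_natCast_eq (m - 1 - c)
  obtain rfl : c = m - 1 - u := by rw [huc]; ring
  rw [decreasingElt, h, code_wordProd_prefix A m le_rfl hu]
  congr 1
  apply propext
  refine ⟨fun h1 => h1.2, fun h1 => ⟨?_, h1⟩⟩
  rcases hu.lt_or_eq with hu | rfl
  · exact hu
  · refine absurd ?_ hm
    have := natCast_succ_self u
    rwa [show m - 1 - (u : ZMod (u + 1)) = m by linear_combination -this] at h1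

theorem mem_rightDescents_decreasingElt {k : ℕ} [NeZero k] {A : Finset (ZMod (k + 1))}
    (hA : A ≠ Finset.univ) (r : ZMod (k + 1)) :
    r ∈ rightDescents k (decreasingElt k A) ↔ r ∈ A ∧ r - 1 ∉ A := by
  rw [(show IsPeriodic k (decreasingElt k A) from
    isPeriodic_wordProd _).mem_rightDescents_iff, code_decreasingElt hA, code_decreasingElt hA]
  split_ifs with h1 h2 <;> simp_all

/-! ### Maximal decompositions -/

theorem toLex_le_toLex_iff_succ (f g : ℕ → ℕ) :
    toLex f ≤ toLex g ↔
      f 0 < g 0 ∨ f 0 = g 0 ∧ toLex (fun j => f (j + 1)) ≤ toLex (fun j => g (j + 1)) := by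
  rw [le_iff_eq_or_lt, le_iff_eq_or_lt]
  constructor
  · rintro (h | ⟨i, hi, hl⟩)
    · have h : f = g := h
      subst h
      exact Or.inr ⟨rfl, Or.inl rfl⟩
    · cases i with
      | zero => exact Or.inl hl
      | succ i =>
        exact Or.inr ⟨hi 0 (Nat.succ_pos i), Or.inr ⟨i, fun j hj => hi (j + 1) (by omega), hl⟩⟩
  · rintro (h | ⟨h0, h | ⟨i, hi, hl⟩⟩)
    · exact Or.inr ⟨0, fun j hj => absurd hj (Nat.not_lt_zero j), h⟩
    · refine Or.inl (congrArg toLex (funext fun j => ?_))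
      cases j with
      | zero => exact h0
      | succ j => exact congrFun (congrArg ofLex h) j
    · refine Or.inr ⟨i + 1, fun j hj => ?_, hl⟩
      cases j with
      | zero => exact h0
      | succ j => exact hi j (by omega)

theorem productWord_cons {k : ℕ} (S : Finset (ZMod (k + 1))) (L : List (Finset (ZMod (k + 1)))) :
    productWord k (S :: L) = productWord k L ++ decreasingWord k S := by
  simp [productWord]

theorem wordProd_reverse_mul_wordProd {k : ℕ} [NeZero k] (w : List (ZMod (k + 1))) :
    wordProd k w.reverse * wordProd k w = 1 := by
  simpa using wordProd_mul_wordProd_reverse w.reverse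

/-- Splitting off the support repeatedly ends at the identity. This word attains the lower bound
`invNumber_wordProd_le`, so inversion number and Coxeter length agree. -/
theorem exists_productWord {k : ℕ} [NeZero k] {x : Equiv.Perm ℤ} (hx : IsPeriodic k x)
    (hd : displacement k x = 0) : ∃ L : List (Finset (ZMod (k + 1))),
      (∀ S ∈ L, S ≠ Finset.univ) ∧ wordProd k (productWord k L) = x ∧
        (productWord k L).length = invNumber k x := by
  induction hn : invNumber k x using Nat.strong_induction_on generalizing x with
  | _ n ih =>
    by_cases h0 : n = 0
    · subst h0
      exact ⟨[], by simp, by rw [eq_one_of_invNumber_eq_zero hx hd hn]; rfl, by simp [productWord]⟩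
    · have hS := hx.codeSupport_ne_univ
      have h1 := invNumber_mul_reverse_codeSupport hx
      have hw := isPeriodic_wordProd (decreasingWord k (codeSupport k x)).reverse
      have h2 : 0 < (codeSupport k x).card := by
        rw [Finset.card_pos, Finset.nonempty_iff_ne_empty]
        intro he
        refine h0 (hn ▸ Finset.sum_eq_zero fun c _ => ?_)
        have : c ∉ codeSupport k x := by simp [he]
        rwa [mem_codeSupport, not_lt, Nat.le_zero] at this
      obtain ⟨L, hL1, hL2, hL3⟩ := ih _ (by omega) (hx.mul hw)
        (by rw [displacement_mul hx hw, hd, displacement_wordProd, add_zero]) rfl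
      refine ⟨codeSupport k x :: L, ?_, ?_, ?_⟩
      · intro S hS'
        rcases List.mem_cons.1 hS' with rfl | h
        · exact hS
        · exact hL1 S h
      · rw [productWord_cons, wordProd_append, hL2, mul_assoc, wordProd_reverse_mul_wordProd,
          mul_one]
      · rw [productWord_cons, List.length_append, hL3, length_decreasingWord hS]
        omega

theorem isDecomposition_iff {k : ℕ} [NeZero k] {x : Equiv.Perm ℤ}
    {A : List (Finset (ZMod (k + 1)))} :
    IsDecomposition k x A ↔ (∀ S ∈ A, S ≠ Finset.univ) ∧ wordProd k (productWord k A) = x ∧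
      (productWord k A).length = invNumber k x := by
  constructor
  · rintro ⟨h1, rfl, h2⟩
    refine ⟨h1, rfl, le_antisymm ?_ (invNumber_wordProd_le _)⟩
    obtain ⟨L, -, hL2, hL3⟩ := exists_productWord (isPeriodic_wordProd (productWord k A))
      (displacement_wordProd _)
    exact hL3 ▸ h2 _ hL2
  · rintro ⟨h1, rfl, h2⟩
    exact ⟨h1, rfl, fun w hw => h2 ▸ hw ▸ invNumber_wordProd_le w⟩

theorem IsDecomposition.isPeriodic {k : ℕ} [NeZero k] {x : Equiv.Perm ℤ}
    {A : List (Finset (ZMod (k + 1)))} (h : IsDecomposition k x A) : IsPeriodic k x :=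
  h.2.1 ▸ isPeriodic_wordProd _

theorem isDecomposition_cons_iff {k : ℕ} [NeZero k] {x : Equiv.Perm ℤ}
    {S : Finset (ZMod (k + 1))} {L : List (Finset (ZMod (k + 1)))} (hx : IsPeriodic k x) :
    IsDecomposition k x (S :: L) ↔ S ≠ Finset.univ ∧
      IsDecomposition k (x * wordProd k (decreasingWord k S).reverse) L ∧
      invNumber k (x * wordProd k (decreasingWord k S).reverse) + S.card = invNumber k x := by
  rw [isDecomposition_iff, isDecomposition_iff, productWord_cons, wordProd_append,
    List.length_append, List.forall_mem_cons]
  constructor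
  · rintro ⟨⟨h1, h2⟩, h3, h4⟩
    have h5 : x * wordProd k (decreasingWord k S).reverse = wordProd k (productWord k L) := by
      rw [← h3, mul_assoc, wordProd_mul_wordProd_reverse, mul_one]
    have h6 := invNumber_le_mul_wordProd hx (decreasingWord k S).reverse
    have h7 := invNumber_wordProd_le (productWord k L)
    rw [List.length_reverse, length_decreasingWord h1] at h6
    rw [length_decreasingWord h1] at h4
    rw [← h5] at h7
    exact ⟨h1, ⟨h2, h5.symm, by omega⟩, by omega⟩
  · rintro ⟨h1, ⟨h2, h3, h4⟩, h5⟩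
    refine ⟨⟨h1, h2⟩, ?_, ?_⟩
    · rw [h3, mul_assoc, wordProd_reverse_mul_wordProd, mul_one]
    · rw [h4, length_decreasingWord h1, h5]

theorem exists_isDecomposition {k : ℕ} [NeZero k] {x : Equiv.Perm ℤ} (hx : IsPeriodic k x)
    (hd : displacement k x = 0) : ∃ L, IsDecomposition k x L := by
  obtain ⟨L, hL⟩ := exists_productWord hx hd
  exact ⟨L, isDecomposition_iff.2 hL⟩

theorem shape_cons_zero {k : ℕ} (S : Finset (ZMod (k + 1))) (L : List (Finset (ZMod (k + 1)))) :
    shape k (S :: L) 0 = S.card := rfl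

/-- The first set of a maximal decomposition is the support of the Lehmer code, and the remaining
sets form a maximal decomposition. -/
theorem IsMaximalDecomposition.of_cons {k : ℕ} [NeZero k] {x : Equiv.Perm ℤ}
    {S : Finset (ZMod (k + 1))} {L : List (Finset (ZMod (k + 1)))}
    (h : IsMaximalDecomposition k x (S :: L)) : S = codeSupport k x ∧
      IsMaximalDecomposition k (x * wordProd k (decreasingWord k S).reverse) L := by
  obtain ⟨h1, h2⟩ := h
  have hx := h1.isPeriodic
  have hd : displacement k x = 0 := h1.2.1 ▸ displacement_wordProd _
  obtain ⟨h3, h4, h5⟩ := (isDecomposition_cons_iff hx).1 h1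
  have hw := isPeriodic_wordProd (decreasingWord k (codeSupport k x)).reverse
  obtain ⟨M, hM⟩ := exists_isDecomposition (hx.mul hw)
    (by rw [displacement_mul hx hw, hd, displacement_wordProd, add_zero])
  -- Comparison with a decomposition starting with the support gives that the support has at most
  -- `S.card` elements, while `S` is contained in it.
  have h6 := h2 _ ((isDecomposition_cons_iff hx).2
    ⟨hx.codeSupport_ne_univ, hM, invNumber_mul_reverse_codeSupport hx⟩)
  rw [toLex_le_toLex_iff_succ, shape_cons_zero, shape_cons_zero] at h6
  refine ⟨Finset.eq_of_subset_of_card_le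
    (fun r hr => mem_codeSupport.2 (code_pos_of_invNumber hx h3 h5 hr)) (by omega), h4, ?_⟩
  intro N hN
  have h7 := h2 _ ((isDecomposition_cons_iff hx).2 ⟨h3, hN, h5⟩)
  rw [toLex_le_toLex_iff_succ, shape_cons_zero, shape_cons_zero] at h7
  rcases h7 with h7 | ⟨-, h7⟩
  · exact absurd h7 (lt_irrefl _)
  · exact h7

/-- The left shift of the code after each removed row is what produces the residue `c - j`. -/
theorem IsMaximalDecomposition.mem_rowSet_iff {k : ℕ} [NeZero k] {x : Equiv.Perm ℤ}
    {A : List (Finset (ZMod (k + 1)))} (h : IsMaximalDecomposition k x A) (j : ℕ)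
    (c : ZMod (k + 1)) : c - j ∈ rowSet k A j ↔ j < code k x c := by
  induction A generalizing x j c with
  | nil =>
    obtain rfl : 1 = x := h.1.2.1
    simp [rowSet, code_one]
  | cons S L ih =>
    have hx := h.1.isPeriodic
    obtain ⟨rfl, h2⟩ := h.of_cons
    cases j with
    | zero => simp [rowSet, mem_codeSupport]
    | succ j =>
      have h3 := ih h2 j (c - 1)
      rw [code_mul_reverse_codeSupport hx, sub_add_cancel] at h3
      rw [show c - ((j + 1 : ℕ) : ZMod (k + 1)) = c - 1 - j by push_cast; ring]
      refine h3.trans ?_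
      omega

/-! ### Fillings of codes and the conclusion -/

theorem KCode.mem_row_iff {k : ℕ} (T : KCode k) (j : ℕ) (c : ZMod (k + 1)) :
    c - j ∈ T.row j ↔ j < T.height c := by
  simp [KCode.row, residue]

theorem KCode.ext_of_hasRows {k : ℕ} {T U : KCode k} {A : List (Finset (ZMod (k + 1)))}
    (hT : T.HasRows A) (hU : U.HasRows A) : T = U := by
  have h : T.height = U.height := by
    funext c
    have h1 : ∀ j : ℕ, j < T.height c ↔ j < U.height c := fun j => by
      rw [← T.mem_row_iff, ← U.mem_row_iff, hT j, hU j]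
    exact le_antisymm (not_lt.1 fun h2 => lt_irrefl _ ((h1 _).1 h2))
      (not_lt.1 fun h2 => lt_irrefl _ ((h1 _).2 h2))
  cases T
  cases U
  cases h
  rfl

end AffineCode

theorem mainTheorem11 (k : ℕ) [NeZero k] (x : Equiv.Perm ℤ) (hx : AffineCode.IsAffinePerm k x)
    (A : List (Finset (ZMod (k + 1)))) (hA : AffineCode.IsMaximalDecomposition k x A) :
    ∃! T : AffineCode.KCode k, T.HasRows A ∧
      (∀ r : ZMod (k + 1),
        r ∈ AffineCode.rightDescents k x ↔
          ∃ c : ZMod (k + 1),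
            (0 < T.height c ∧ AffineCode.residue k c 0 = r) ∧
            ∃ j : ℕ, j < T.height c ∧
              AffineCode.residue k c j ∈
                AffineCode.rightDescents k
                  (AffineCode.decreasingElt k (AffineCode.rowSet k A j))) ∧
      AffineCode.rightDescents k x = T.descents := by
  have hp : AffineCode.IsPeriodic k x := hx.1
  let T : AffineCode.KCode k := ⟨AffineCode.code k x, hp.exists_code_eq_zero⟩
  have hrows : T.HasRows A := by
    intro j
    ext c
    have h1 := T.mem_row_iff j (c + j)
    have h2 := hA.mem_rowSet_iff j (c + j)
    rw [add_sub_cancel_right] at h1 h2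
    exact h1.trans h2.symm
  have hproper : ∀ j, AffineCode.rowSet k A j ≠ Finset.univ := by
    intro j h
    obtain ⟨c, hc⟩ := hp.exists_code_eq_zero
    have := (hA.mem_rowSet_iff j c).1 (h ▸ Finset.mem_univ _)
    omega
  have hdesc : AffineCode.rightDescents k x = T.descents := by
    ext r
    exact hp.mem_rightDescents_iff r
  refine ⟨T, ⟨hrows, fun r => ?_, hdesc⟩, fun U hU => AffineCode.KCode.ext_of_hasRows hU.1 hrows⟩
  have hres : ∀ c j, AffineCode.residue k c j ∈ AffineCode.rightDescents k
      (AffineCode.decreasingElt k (AffineCode.rowSet k A j)) ↔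
        j < AffineCode.code k x c ∧ ¬ j < AffineCode.code k x (c - 1) := by
    intro c j
    rw [AffineCode.mem_rightDescents_decreasingElt (hproper j), ← hA.mem_rowSet_iff,
      ← hA.mem_rowSet_iff, AffineCode.residue, sub_right_comm]
  rw [hp.mem_rightDescents_iff]
  constructor
  · intro h
    -- The row is the height of column `r - 1`: the first row, counted from 0, that this column
    -- misses.
    exact ⟨r, ⟨Nat.zero_lt_of_lt h, by simp [AffineCode.residue]⟩, _, h,
      (hres _ _).2 ⟨h, lt_irrefl _⟩⟩
  · rintro ⟨c, ⟨-, hc⟩, j, -, hj⟩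
    obtain rfl : c = r := by simpa [AffineCode.residue] using hc
    obtain ⟨h1, h2⟩ := (hres _ _).1 hj
    omega
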